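/- Fix $k_1,k_2,k_3\in\mathbb Z_{\ge 0}$ and a permutation $\sigma$ of $\{1,2,3\}$, and put $K=3+k_1+k_2+k_3$. **Generalized Cohn matrices.** The Farey tree has root $(\frac01,\frac11,\frac10)$, and a vertex $(r,t,s)$ has the left child $(r,r\oplus t,t)$ and the right child $(t,t\oplus s,s)$, where $\frac ab\oplus\frac cd=\frac{a+c}{b+d}$; every positive rational is the middle entry of exactly one vertex. The generalized Markov tree has root $((1,\sigma(1)),(k_{\sigma(2)}+2,\sigma(2)),(1,\sigma(3)))$, and a vertex $((a,h),(b,i),(c,j))$ has the left child $\big((a,h),\big(\frac{a^2+k_jab+b^2}{c},j\big),(b,i)\big)$ and the right child $\big((b,i),\big(\frac{b^2+k_hbc+c^2}{a},h\big),(c,j)\big)$. If $((m_r,i_r),(m_t,i_t),(m_s,i_s))$ is the vertex in the same position as the Farey triple $(r,t,s)$, put $D_r=\begin{bmatrix}k_{i_r}&Kk_{i_r}\\0&k_{i_r}\end{bmatrix}$ and $D_s=\begin{bmatrix}k_{i_s}&Kk_{i_s}\\0&k_{i_s}\end{bmatrix}$. The generalized Cohn matrices are defined by $$C_{\frac01}=\begin{bmatrix}K&-Kk_{\sigma(1)}-1\\1&-k_{\sigma(1)}\end{bmatrix},\quad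 C_{\frac11}=\begin{bmatrix}K(k_{\sigma(2)}+2)-k_{\sigma(2)}-1&K-1\\k_{\sigma(2)}+2&1\end{bmatrix},\quad C_{\frac10}=\begin{bmatrix}K-k_{\sigma(3)}-1&K-k_{\sigma(3)}-2\\1&1\end{bmatrix}$$ and, for each vertex $(r,t,s)$ of the Farey tree, $C_{r\oplus t}=C_rC_t-D_s$ and $C_{t\oplus s}=C_tC_s-D_r$. **Endpoint-completed words.** Let $t=\frac pq$ be a positive rational in lowest terms. Consider the square grid on $\mathbb Z^2$ together with all diagonals of slope $-1$ of its unit squares. Let $\varepsilon>0$ be so small that for no $0<\varepsilon'\le\varepsilon$ the segment from $(-\varepsilon',0)$ to $(q-\varepsilon',p)$ meets a lattice vertex or the midpoint of an edge, and let $\overline L_t$ be the segment oriented from $(-\varepsilon,0)$ to $(q-\varepsilon,p)$. Read, in order, the edges whose interior meets $\overline L_t$, where the initial end point of $\overline L_t$ is included and its terminal end point is not. A horizontal, diagonal, or vertical edge contributes $x^{\pm1}$, $y^{\pm1}$, or $z^{\pm1}$, respectively, with exponent $-1$ if the midpoint of the edge lies on the right-hand side of $\overline L_t$, and $+1$ otherwise.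 The word $\overline\omega_t$ in the free group on $x,y,z$ obtained in this way is the endpoint-completed word of $t$. Let $\overline M_t$ be its value under $x\mapsto X$, $y\mapsto Y$, $z\mapsto Z$, where $$X=\begin{bmatrix}-k_{\sigma(1)}&-1\\1&0\end{bmatrix},\quad Y=\begin{bmatrix}1&-1\\k_{\sigma(2)}+2&-k_{\sigma(2)}-1\end{bmatrix},\quad Z=\begin{bmatrix}1&-k_{\sigma(3)}-2\\1&-k_{\sigma(3)}-1\end{bmatrix}.$$ **Theorem.** For every positive rational $t$ (and every such $\varepsilon$), one has $$C_t=\begin{bmatrix}-1&0\\0&1\end{bmatrix}\,\overline M_t\,\begin{bmatrix}1&0\\0&-1\end{bmatrix}.$$ -/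

import Mathlib

namespace GenCohn

/-! The Farey tree, the labelled generalized Markov tree and the generalized Cohn matrices.
The index set `{1,2,3}` is modelled by `Fin 3 = {0,1,2}`, so `k 0, k 1, k 2` are the parameters
`k₁, k₂, k₃` and `σ 0, σ 1, σ 2` are `σ(1), σ(2), σ(3)`. -/

/-- The vertices of the rooted planar (complete) binary tree. -/
inductive TreeVertex : Type
  | root : TreeVertex
  | left : TreeVertex → TreeVertex
  | right : TreeVertex → TreeVertex

/-- A fraction `num / den` of natural numbers (with `1 / 0` allowed). -/
@[ext] structure Frac where
  num : ℕ
  den : ℕ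

/-- The mediant `a/b ⊕ c/d = (a+c)/(b+d)`. -/
def Frac.mediant (r s : Frac) : Frac := ⟨r.num + s.num, r.den + s.den⟩

/-- The triple of the Farey tree at a vertex, as `(r, t, s)`. -/
def farey : TreeVertex → Frac × Frac × Frac
  | .root => (⟨0, 1⟩, ⟨1, 1⟩, ⟨1, 0⟩)
  | .left v => ((farey v).1, (farey v).1.mediant (farey v).2.1, (farey v).2.1)
  | .right v => ((farey v).2.1, (farey v).2.1.mediant (farey v).2.2, (farey v).2.2)

/-- The triple `((m_r, i_r), (m_t, i_t), (m_s, i_s))` of the `(k₁,k₂,k₃,σ)`-generalized Markov tree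
at a vertex: numbers with their position labels. -/
def markov (k : Fin 3 → ℕ) (σ : Equiv.Perm (Fin 3)) :
    TreeVertex → (ℚ × Fin 3) × (ℚ × Fin 3) × (ℚ × Fin 3)
  | .root => ((1, σ 0), ((k (σ 1) : ℚ) + 2, σ 1), (1, σ 2))
  | .left v =>
    match markov k σ v with
    | ((a, h), (b, i), (c, j)) =>
      ((a, h), ((a ^ 2 + k j * a * b + b ^ 2) / c, j), (b, i))
  | .right v =>
    match markov k σ v with
    | ((a, h), (b, i), (c, j)) =>
      ((b, i), ((b ^ 2 + k h * b * c + c ^ 2) / a, h), (c, j))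

/-- `K = 3 + k₁ + k₂ + k₃`. -/
def bigK (k : Fin 3 → ℕ) : ℤ := 3 + k 0 + k 1 + k 2

/-- The constant matrix with parameter `k_i` that is subtracted in the Cohn recursion. -/
def constMat (k : Fin 3 → ℕ) (i : Fin 3) : Matrix (Fin 2) (Fin 2) ℤ :=
  !![(k i : ℤ), bigK k * k i; 0, (k i : ℤ)]

/-- The triple `(C_r, C_t, C_s)` of generalized Cohn matrices attached to the Farey triple
`(r, t, s)` at a vertex. -/
def cohnTriple (k : Fin 3 → ℕ) (σ : Equiv.Perm (Fin 3)) : TreeVertex →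
    Matrix (Fin 2) (Fin 2) ℤ × Matrix (Fin 2) (Fin 2) ℤ × Matrix (Fin 2) (Fin 2) ℤ
  | .root =>
    (!![bigK k, -bigK k * k (σ 0) - 1; 1, -(k (σ 0) : ℤ)],
     !![bigK k * (k (σ 1) + 2) - k (σ 1) - 1, bigK k - 1; (k (σ 1) : ℤ) + 2, 1],
     !![bigK k - k (σ 2) - 1, bigK k - k (σ 2) - 2; 1, 1])
  | .left v =>
    match cohnTriple k σ v with
    | (Cr, Ct, _) => (Cr, Cr * Ct - constMat k (markov k σ v).2.2.2, Ct)
  | .right v =>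
    match cohnTriple k σ v with
    | (_, Ct, Cs) => (Ct, Ct * Cs - constMat k (markov k σ v).1.2, Cs)

/-! Every positive rational is the middle entry of exactly one vertex of the Farey tree. -/

theorem farey_mid (v : TreeVertex) :
    (farey v).2.1 = (farey v).1.mediant (farey v).2.2 := by
  cases v <;> simp [farey, Frac.mediant]

theorem farey_det (v : TreeVertex) :
    (farey v).2.2.num * (farey v).1.den = (farey v).1.num * (farey v).2.2.den + 1 := by
  induction v with
  | root => simp [farey]
  | left v ih =>
    simp only [farey, farey_mid v, Frac.mediant]
    nlinarith
  | right v ih =>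
    simp only [farey, farey_mid v, Frac.mediant]
    nlinarith

theorem farey_pos (v : TreeVertex) :
    0 < (farey v).1.den ∧ 0 < (farey v).2.2.num := by
  induction v with
  | root => simp [farey]
  | left v ih => simp only [farey, farey_mid v, Frac.mediant]; omega
  | right v ih => simp only [farey, farey_mid v, Frac.mediant]; omega

theorem farey_outer_injective (v w : TreeVertex) (h1 : (farey v).1 = (farey w).1)
    (h2 : (farey v).2.2 = (farey w).2.2) : v = w := by
  induction v generalizing w with
  | root =>
    cases w with
    | root => rfl
    | left w =>
      have := farey_pos w
      simp only [farey, farey_mid w, Frac.mediant, Frac.ext_iff] at h1 h2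
      omega
    | right w =>
      have := farey_pos w
      simp only [farey, farey_mid w, Frac.mediant, Frac.ext_iff] at h1 h2
      omega
  | left v ih =>
    have hv := farey_pos v
    cases w with
    | root =>
      simp only [farey, farey_mid v, Frac.mediant, Frac.ext_iff] at h1 h2
      omega
    | left w =>
      simp only [farey, farey_mid v, farey_mid w, Frac.mediant, Frac.ext_iff] at h1 h2
      rw [ih w (by ext <;> omega) (by ext <;> omega)]
    | right w =>
      have := farey_pos w
      simp only [farey, farey_mid v, farey_mid w, Frac.mediant, Frac.ext_iff] at h1 h2
      omega
  | right v ih =>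
    have hv := farey_pos v
    cases w with
    | root =>
      simp only [farey, farey_mid v, Frac.mediant, Frac.ext_iff] at h1 h2
      omega
    | left w =>
      have := farey_pos w
      simp only [farey, farey_mid v, farey_mid w, Frac.mediant, Frac.ext_iff] at h1 h2
      omega
    | right w =>
      simp only [farey, farey_mid v, farey_mid w, Frac.mediant, Frac.ext_iff] at h1 h2
      rw [ih w (by ext <;> omega) (by ext <;> omega)]

theorem farey_mid_injective (v w : TreeVertex) (h : (farey v).2.1 = (farey w).2.1) : v = w := by
  have hv := farey_mid v
  have hw := farey_mid w
  have dv := farey_det v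
  have dw := farey_det w
  have pv := farey_pos v
  have pw := farey_pos w
  rw [hv, hw] at h
  obtain ⟨hc, hd⟩ := Frac.ext_iff.1 h
  simp only [Frac.mediant] at hc hd
  have key : (farey v).1.den = (farey w).1.den := by
    generalize (farey v).1 = r, (farey v).2.2 = s, (farey w).1 = r', (farey w).2.2 = s' at *
    obtain ⟨a, b⟩ := r
    obtain ⟨e, f⟩ := s
    obtain ⟨a', b'⟩ := r'
    obtain ⟨e', f'⟩ := s'
    simp only at *
    zify at *
    have h1 : (a + e : ℤ) * b - a * (b + f) = 1 := by linarith
    have h2 : (a + e : ℤ) * b' - a' * (b + f) = 1 := by rw [hc, hd]; linarith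
    have hdvd : (b + f : ℤ) ∣ b - b' := by
      refine ⟨b * (a - a') - a * (b - b'), ?_⟩
      linear_combination (b - b' : ℤ) * (-h1) + (b : ℤ) * (h1 - h2)
    have := Int.eq_zero_of_abs_lt_dvd hdvd (by rw [abs_lt]; constructor <;> linarith)
    linarith
  have key2 : (farey v).1.num = (farey w).1.num := by
    generalize (farey v).1 = r, (farey v).2.2 = s, (farey w).1 = r', (farey w).2.2 = s' at *
    obtain ⟨a, b⟩ := r
    obtain ⟨e, f⟩ := s
    obtain ⟨a', b'⟩ := r'
    obtain ⟨e', f'⟩ := s'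
    simp only at *
    subst key
    have hf : f = f' := by omega
    subst hf
    zify at *
    have hbf : (0 : ℤ) < b + f := by linarith
    refine mul_right_cancel₀ hbf.ne' ?_
    linear_combination (b : ℤ) * hc - dv + dw
  exact farey_outer_injective v w (by ext <;> omega) (by ext <;> omega)

theorem farey_mid_exists (u w : ℕ) (v : TreeVertex) (hu : 0 < u) (hw : 0 < w)
    (h : Nat.Coprime u w) : ∃ v', (farey v').2.1 =
      ⟨w * (farey v).1.num + u * (farey v).2.2.num, w * (farey v).1.den + u * (farey v).2.2.den⟩ := by
  induction hn : u + w using Nat.strong_induction_on generalizing u w v with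
  | _ n ih =>
    subst hn
    rcases lt_trichotomy u w with hlt | heq | hgt
    · obtain ⟨d, rfl⟩ := Nat.exists_eq_add_of_lt hlt
      obtain ⟨v', hv'⟩ := ih (u + (d + 1)) (by omega) u (d + 1) (.left v) hu (by omega)
        (by simpa [Nat.add_assoc] using h) rfl
      refine ⟨v', hv'.trans ?_⟩
      simp only [farey, farey_mid v, Frac.mediant]
      ext <;> simp only <;> ring
    · subst heq
      have : u = 1 := by simpa using h
      subst this
      exact ⟨v, by simp [farey_mid v, Frac.mediant]⟩
    · obtain ⟨d, rfl⟩ := Nat.exists_eq_add_of_lt hgt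
      obtain ⟨v', hv'⟩ := ih ((d + 1) + w) (by omega) (d + 1) w (.right v) (by omega) hw
        (by simpa [Nat.add_assoc] using h) rfl
      refine ⟨v', hv'.trans ?_⟩
      simp only [farey, farey_mid v, Frac.mediant]
      ext <;> simp only <;> ring

theorem existsUnique_vertex (t : ℚ) (ht : 0 < t) :
    ∃! v : TreeVertex, (farey v).2.1 = ⟨t.num.toNat, t.den⟩ := by
  have hnum : 0 < t.num := Rat.num_pos.2 ht
  obtain ⟨v, hv⟩ := farey_mid_exists t.num.toNat t.den .root (by omega) t.den_pos (by
    have := t.reduced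
    rwa [show t.num.natAbs = t.num.toNat by omega] at this)
  simp only [farey] at hv
  refine ⟨v, by simpa using hv, fun w hw => farey_mid_injective w v ?_⟩
  rw [hw]; simpa using hv.symm

/-- The unique vertex of the Farey tree whose middle entry is the positive rational `t`. -/
noncomputable def vertexOf (t : ℚ) (ht : 0 < t) : TreeVertex :=
  (existsUnique_vertex t ht).choose

/-- The `(k₁,k₂,k₃,σ)`-generalized Cohn matrix `C_t` of a positive rational `t`. -/
noncomputable def cohnMatrix (k : Fin 3 → ℕ) (σ : Equiv.Perm (Fin 3)) (t : ℚ) (ht : 0 < t) :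
    Matrix (Fin 2) (Fin 2) ℤ :=
  (cohnTriple k σ (vertexOf t ht)).2.1

/-! The modified lattice and the shifted segment. -/

/-- Generators of the free group `𝔉₃`. -/
inductive Letter : Type
  | x : Letter
  | y : Letter
  | z : Letter

/-- The three kinds of edges of the modified lattice. -/
inductive EdgeKind : Type
  | horizontal : EdgeKind
  | diagonal : EdgeKind
  | vertical : EdgeKind

/-- The letter carried by an edge of a given kind. -/
def EdgeKind.letter : EdgeKind → Letter
  | .horizontal => .x
  | .diagonal => .y
  | .vertical => .z

/-- The edges of the modified lattice: the square grid on `ℤ²` with all slope `-1` diagonals of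
unit squares. The pair `(i, j)` is the lower left corner of the horizontal or vertical edge,
respectively of the unit square that contains the diagonal edge. -/
structure GridEdge where
  kind : EdgeKind
  i : ℤ
  j : ℤ

/-- First end point of an edge. -/
def GridEdge.fst (e : GridEdge) : ℝ × ℝ :=
  match e.kind with
  | .horizontal => (e.i, e.j)
  | .diagonal => (e.i, e.j + 1)
  | .vertical => (e.i, e.j)

/-- Second end point of an edge. -/
def GridEdge.snd (e : GridEdge) : ℝ × ℝ :=
  match e.kind with
  | .horizontal => (e.i + 1, e.j)
  | .diagonal => (e.i + 1, e.j)
  | .vertical => (e.i, e.j + 1)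

/-- The point with parameter `s ∈ [0,1]` of the segment from `(-ε, 0)` to `(q - ε, p)`, where
`t = p / q` in lowest terms. -/
noncomputable def shiftedPoint (t : ℚ) (ε s : ℝ) : ℝ × ℝ :=
  (s * t.den - ε, s * t.num)

/-- `ε > 0` is sufficiently small for `t`: no segment obtained from the segment from `(0,0)` to
`(q,p)` by a translation by `(-ε', 0)` with `0 < ε' ≤ ε` meets a lattice vertex or the midpoint of
an edge. (So, while the segment is moved to its final position, it never passes a vertex or a
midpoint, and the order of the crossings away from the end points does not change.) -/
def IsSmallShift (t : ℚ) (ε : ℝ) : Prop :=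
  0 < ε ∧ ∀ ε' : ℝ, 0 < ε' → ε' ≤ ε → ∀ s ∈ Set.Icc (0 : ℝ) 1,
    (∀ i j : ℤ, shiftedPoint t ε' s ≠ ((i : ℝ), (j : ℝ))) ∧
    ∀ e : GridEdge, shiftedPoint t ε' s ≠ midpoint ℝ e.fst e.snd

/-- The shifted segment, with its initial end point and without its terminal end point, meets the
interior of the edge `e` at the parameter `s`. -/
def CrossesAt (t : ℚ) (ε : ℝ) (e : GridEdge) (s : ℝ) : Prop :=
  s ∈ Set.Ico (0 : ℝ) 1 ∧ shiftedPoint t ε s ∈ openSegment ℝ e.fst e.snd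

/-- The set of edges that are counted as crossed by the shifted segment. -/
def crossedEdges (t : ℚ) (ε : ℝ) : Set GridEdge := {e | ∃ s, CrossesAt t ε e s}

/-- The parameter at which the line through the shifted segment meets the line through `e`. -/
noncomputable def crossParam (t : ℚ) (ε : ℝ) (e : GridEdge) : ℝ :=
  match e.kind with
  | .horizontal => e.j / t.num
  | .diagonal => (e.i + e.j + 1 + ε) / (t.num + t.den)
  | .vertical => (e.i + ε) / t.den

theorem CrossesAt.bounds {t : ℚ} {ε : ℝ} {e : GridEdge} {s : ℝ}
    (h : CrossesAt t ε e s) :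
    (e.i : ℝ) ≤ s * t.den - ε ∧ s * t.den - ε ≤ e.i + 1 ∧
      (e.j : ℝ) ≤ s * t.num ∧ s * t.num ≤ e.j + 1 := by
  obtain ⟨⟨h0, h1⟩, a, b, ha, hb, hab, h⟩ := h
  obtain ⟨kd, i, j⟩ := e
  cases kd <;>
    simp only [GridEdge.fst, GridEdge.snd, shiftedPoint, Prod.smul_mk, Prod.mk_add_mk,
      smul_eq_mul, Prod.mk.injEq] at h ⊢ <;>
    obtain ⟨h2, h3⟩ := h <;>
    obtain rfl : a = 1 - b := by linarith
  all_goals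
    refine ⟨?_, ?_, ?_, ?_⟩ <;> nlinarith

theorem CrossesAt.eq_crossParam {t : ℚ} (ht : 0 < t) {ε : ℝ} {e : GridEdge} {s : ℝ}
    (h : CrossesAt t ε e s) : s = crossParam t ε e := by
  have hp : (0 : ℝ) < t.num := by exact_mod_cast Rat.num_pos.2 ht
  have hq : (0 : ℝ) < t.den := by exact_mod_cast t.den_pos
  obtain ⟨-, a, b, ha, hb, hab, h⟩ := h
  obtain ⟨kd, i, j⟩ := e
  cases kd <;>
    simp only [GridEdge.fst, GridEdge.snd, shiftedPoint, Prod.smul_mk, Prod.mk_add_mk,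
      smul_eq_mul, Prod.mk.injEq, crossParam] at h ⊢ <;>
    obtain ⟨h2, h3⟩ := h <;>
    obtain rfl : a = 1 - b := by linarith
  all_goals
    rw [eq_div_iff (by positivity)]
    nlinarith

theorem crossedEdges_finite (t : ℚ) (ε : ℝ) : (crossedEdges t ε).Finite := by
  obtain ⟨N, hN⟩ := exists_nat_ge (|ε| + t.den + |(t.num : ℝ)| + 1)
  have hfin : ∀ c : EdgeKind, ((fun x : ℤ × ℤ => GridEdge.mk c x.1 x.2) ''
      (Set.Icc (-(N : ℤ)) N ×ˢ Set.Icc (-(N : ℤ)) N)).Finite := fun c =>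
    ((Set.finite_Icc _ _).prod (Set.finite_Icc _ _)).image _
  refine ((hfin .horizontal).union ((hfin .diagonal).union (hfin .vertical))).subset ?_
  rintro ⟨c, i, j⟩ ⟨s, hs⟩
  obtain ⟨b1, b2, b3, b4⟩ := hs.bounds
  simp only at b1 b2 b3 b4
  obtain ⟨⟨h0, h1⟩, -⟩ := hs
  have hq : (0 : ℝ) ≤ t.den := by positivity
  have e1 := abs_le.1 (le_refl |ε|)
  have e2 := abs_le.1 (le_refl |(t.num : ℝ)|)
  have e3 : s * t.den ≤ t.den := mul_le_of_le_one_left hq h1.le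
  have e4 : 0 ≤ s * t.den := mul_nonneg h0 hq
  have e5 : |s * t.num| ≤ |(t.num : ℝ)| := by
    rw [abs_mul, abs_of_nonneg h0]
    exact mul_le_of_le_one_left (abs_nonneg _) h1.le
  have e6 := abs_le.1 e5
  have e7 := abs_nonneg ε
  have e8 := abs_nonneg (t.num : ℝ)
  have hi : i ∈ Set.Icc (-(N : ℤ)) N := by
    constructor <;> (rify; linarith)
  have hj : j ∈ Set.Icc (-(N : ℤ)) N := by
    constructor <;> (rify; linarith)
  have hmem : (i, j) ∈ Set.Icc (-(N : ℤ)) N ×ˢ Set.Icc (-(N : ℤ)) N := ⟨hi, hj⟩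
  cases c
  · exact Or.inl ⟨(i, j), hmem, rfl⟩
  · exact Or.inr (Or.inl ⟨(i, j), hmem, rfl⟩)
  · exact Or.inr (Or.inr ⟨(i, j), hmem, rfl⟩)

/-- Small shifts exist. -/
theorem exists_isSmallShift (t : ℚ) (ht : 0 < t) : ∃ ε, IsSmallShift t ε := by
  have hp : (0 : ℝ) < t.num := by exact_mod_cast Rat.num_pos.2 ht
  have key : ∀ ε' : ℝ, 0 < ε' → ε' ≤ 1 / (4 * t.num) → ∀ s : ℝ, ∀ m n : ℤ,
      shiftedPoint t ε' s ≠ ((m : ℝ) / 2, (n : ℝ) / 2) := by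
    intro ε' h0 h1 s m n h
    simp only [shiftedPoint, Prod.mk.injEq] at h
    obtain ⟨h2, h3⟩ := h
    rw [le_div_iff₀ (by positivity)] at h1
    have h4 : (t.den : ℝ) * n - t.num * m = 2 * (ε' * t.num) := by
      linear_combination 2 * (t.num : ℝ) * h2 - 2 * (t.den : ℝ) * h3
    have h5 : 0 < (t.den : ℤ) * n - t.num * m := by
      rify; rw [h4]; positivity
    have h6 : (t.den : ℤ) * n - t.num * m < 1 := by
      rify; rw [h4]; linarith
    omega
  refine ⟨1 / (4 * t.num), by positivity, fun ε' h0 h1 s _ => ⟨fun i j h => ?_, fun e h => ?_⟩⟩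
  · refine key ε' h0 h1 s (2 * i) (2 * j) (h.trans ?_)
    push_cast
    ext <;> simp only <;> ring
  · obtain ⟨kd, i, j⟩ := e
    have hm : ∀ P Q : ℝ × ℝ, midpoint ℝ P Q = ((P.1 + Q.1) / 2, (P.2 + Q.2) / 2) := by
      intro P Q
      rw [midpoint_eq_smul_add]
      ext <;> simp <;> ring
    rw [hm] at h
    cases kd
    · refine key ε' h0 h1 s (2 * i + 1) (2 * j) (h.trans ?_)
      push_cast
      ext <;> simp only [GridEdge.fst, GridEdge.snd] <;> ring
    · refine key ε' h0 h1 s (2 * i + 1) (2 * j + 1) (h.trans ?_)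
      push_cast
      ext <;> simp only [GridEdge.fst, GridEdge.snd] <;> ring
    · refine key ε' h0 h1 s (2 * i) (2 * j + 1) (h.trans ?_)
      push_cast
      ext <;> simp only [GridEdge.fst, GridEdge.snd] <;> ring

/-- The edges crossed by the shifted segment, in the order in which they are crossed. -/
noncomputable def crossingSequence (t : ℚ) (ε : ℝ) : List GridEdge :=
  (crossedEdges_finite t ε).toFinset.toList.mergeSort
    (fun e e' => decide (crossParam t ε e ≤ crossParam t ε e'))

/-- The point `P` lies (strictly) on the right-hand side of the shifted segment, oriented from
`(-ε, 0)` to `(q - ε, p)`. -/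
def OnRight (t : ℚ) (ε : ℝ) (P : ℝ × ℝ) : Prop :=
  (t.den : ℝ) * P.2 - t.num * (P.1 + ε) < 0

open Classical in
/-- The contribution of an edge to the word: the inverse letter if the midpoint of the edge lies on
the right-hand side of the segment, and the letter otherwise. -/
noncomputable def edgeLetter (t : ℚ) (ε : ℝ) (e : GridEdge) : FreeGroup Letter :=
  if OnRight t ε (midpoint ℝ e.fst e.snd) then (FreeGroup.of e.kind.letter)⁻¹
  else FreeGroup.of e.kind.letter

/-- The endpoint-completed word of `t`, read off the segment shifted by `ε`. -/
noncomputable def completedWord (t : ℚ) (ε : ℝ) : FreeGroup Letter :=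
  ((crossingSequence t ε).map (edgeLetter t ε)).prod

/-! The matrix evaluation. -/

/-- The matrices `X, Y, Z` in `SL(2, ℤ)` that are substituted for the letters `x, y, z`. -/
def letterMatrix (k : Fin 3 → ℕ) (σ : Equiv.Perm (Fin 3)) :
    Letter → Matrix.SpecialLinearGroup (Fin 2) ℤ
  | .x => ⟨!![-(k (σ 0) : ℤ), -1; 1, 0], by simp [Matrix.det_fin_two]⟩
  | .y => ⟨!![1, -1; (k (σ 1) : ℤ) + 2, -(k (σ 1) : ℤ) - 1], by
      simp [Matrix.det_fin_two]; ring⟩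
  | .z => ⟨!![1, -(k (σ 2) : ℤ) - 2; 1, -(k (σ 2) : ℤ) - 1], by
      simp [Matrix.det_fin_two]⟩

/-- The endpoint-completed matrix: the endpoint-completed word evaluated at `X, Y, Z`. -/
noncomputable def completedMatrix (k : Fin 3 → ℕ) (σ : Equiv.Perm (Fin 3)) (t : ℚ) (ε : ℝ) :
    Matrix (Fin 2) (Fin 2) ℤ :=
  (FreeGroup.lift (letterMatrix k σ) (completedWord t ε) : Matrix.SpecialLinearGroup (Fin 2) ℤ)

end GenCohn

namespace GenCohn

/-! Let T = xyz. The braid (Hurwitz) moves down the tree carry (x, y, z) to triples of conjugates of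
x, y, z whose product is always T. Both sides of the theorem come from the same word T u⁻¹, where u
is the middle conjugate at the vertex of t.

Matrix side: T evaluates to the parabolic matrix [[-1, K], [0, -1]], and if a, b, c satisfy c = a⁻¹
T b⁻¹ then (T a⁻¹)(T b⁻¹) = T c. By Cayley–Hamilton T c = tr(c) T - T c⁻¹. The trace of each
conjugate is minus the parameter of its position label, because braid moves permute the conjugacy
classes exactly as Markov mutations permute the labels. The term tr(c) T is thus the constant matrix
of the Cohn recursion (`cohnOf_mul_sub`), and `cohnTriple_eq` follows by induction on the tree.

Word side: for t = p/q the segment crosses diagonals alternately with vertical or horizontal edges,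
and which edge comes next, with which sign, is read off the orbit of 0 under the rotation by p on
ℤ/(p+q) (`completedWord_eq`). Inducing a rotation on a subinterval (Rauzy induction) gives a
rotation with smaller p or q, and on words this is, up to conjugation, the substitution of a braid
move (`RotationPath.left`, `RotationPath.right`). Hence the Euclidean algorithm on (p, q) retraces
the path to t in the tree, starting from the rotation for 1/1, whose word is a conjugate of T y⁻¹
(`exists_rotationPath`). -/

/-! ### Conjugates of the generators attached to the vertices of the tree -/

/-- The triple of conjugates of the three generators attached to a vertex by braid moves. Its
product does not depend on the vertex. -/
def genTriple : TreeVertex → FreeGroup Letter × FreeGroup Letter × FreeGroup Letter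
  | .root => (.of .x, .of .y, .of .z)
  | .left v =>
    ((genTriple v).1, (genTriple v).2.1 * (genTriple v).2.2 * (genTriple v).2.1⁻¹,
      (genTriple v).2.1)
  | .right v =>
    ((genTriple v).2.1, (genTriple v).2.1⁻¹ * (genTriple v).1 * (genTriple v).2.1,
      (genTriple v).2.2)

/-- The boundary word `xyz`. -/
def boundaryWord : FreeGroup Letter := .of .x * .of .y * .of .z

theorem genTriple_prod (v : TreeVertex) :
    (genTriple v).1 * (genTriple v).2.1 * (genTriple v).2.2 = boundaryWord := by
  induction v with
  | root => rfl
  | left v ih => rw [← ih]; simp only [genTriple]; group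
  | right v ih => rw [← ih]; simp only [genTriple]; group

/-- The endomorphism sending the generators to the triple at a vertex. -/
def vertexHom (v : TreeVertex) : FreeGroup Letter →* FreeGroup Letter :=
  FreeGroup.lift fun
    | .x => (genTriple v).1
    | .y => (genTriple v).2.1
    | .z => (genTriple v).2.2

@[simp] theorem vertexHom_x (v : TreeVertex) : vertexHom v (.of .x) = (genTriple v).1 := by
  simp [vertexHom]

@[simp] theorem vertexHom_y (v : TreeVertex) : vertexHom v (.of .y) = (genTriple v).2.1 := by
  simp [vertexHom]

@[simp] theorem vertexHom_z (v : TreeVertex) : vertexHom v (.of .z) = (genTriple v).2.2 := by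
  simp [vertexHom]

theorem vertexHom_root (w : FreeGroup Letter) : vertexHom .root w = w := by
  have : vertexHom .root = MonoidHom.id _ := by
    ext a; cases a <;> simp [genTriple]
  rw [this]; rfl

/-- The braid move below `v` is the root move written in the letters of the triple at `v`; so the
substitution of the last move is applied first. -/
theorem vertexHom_left (v : TreeVertex) (w : FreeGroup Letter) :
    vertexHom (.left v) w = vertexHom v (vertexHom (.left .root) w) := by
  have : vertexHom (.left v) = (vertexHom v).comp (vertexHom (.left .root)) := by
    ext a; cases a <;> simp [genTriple]
  rw [this]; rfl

theorem vertexHom_right (v : TreeVertex) (w : FreeGroup Letter) :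
    vertexHom (.right v) w = vertexHom v (vertexHom (.right .root) w) := by
  have : vertexHom (.right v) = (vertexHom v).comp (vertexHom (.right .root)) := by
    ext a; cases a <;> simp [genTriple]
  rw [this]; rfl

/-! ### The Cohn matrices in terms of the conjugated generators -/

theorem bigK_eq (k : Fin 3 → ℕ) (σ : Equiv.Perm (Fin 3)) :
    bigK k = 3 + k (σ 0) + k (σ 1) + k (σ 2) := by
  have h := Equiv.sum_comp σ fun i => (k i : ℤ)
  simp only [Fin.sum_univ_three] at h
  simp only [bigK]
  linarith

/-- The value of a word under the substitution of `X, Y, Z`. -/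
def evalWord (k : Fin 3 → ℕ) (σ : Equiv.Perm (Fin 3)) :
    FreeGroup Letter →* Matrix.SpecialLinearGroup (Fin 2) ℤ :=
  FreeGroup.lift (letterMatrix k σ)

theorem trace_conj {n R : Type*} [Fintype n] [DecidableEq n] [CommRing R]
    (A B : Matrix.SpecialLinearGroup n R) :
    Matrix.trace (A * B * A⁻¹ : Matrix.SpecialLinearGroup n R).1 = Matrix.trace B.1 := by
  have h : ((A⁻¹ * A : Matrix.SpecialLinearGroup n R) : Matrix n n R) = 1 := by simp
  simp only [Matrix.SpecialLinearGroup.coe_mul] at h ⊢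
  rw [Matrix.trace_mul_comm, ← mul_assoc, h, one_mul]

theorem trace_conj' {n R : Type*} [Fintype n] [DecidableEq n] [CommRing R]
    (A B : Matrix.SpecialLinearGroup n R) :
    Matrix.trace (A⁻¹ * B * A : Matrix.SpecialLinearGroup n R).1 = Matrix.trace B.1 := by
  simpa using trace_conj A⁻¹ B

/-- The traces of the conjugated generators are given by the position labels. -/
theorem trace_genTriple (k : Fin 3 → ℕ) (σ : Equiv.Perm (Fin 3)) (v : TreeVertex) :
    Matrix.trace (evalWord k σ (genTriple v).1).1 = -k (markov k σ v).1.2 ∧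
    Matrix.trace (evalWord k σ (genTriple v).2.1).1 = -k (markov k σ v).2.1.2 ∧
    Matrix.trace (evalWord k σ (genTriple v).2.2).1 = -k (markov k σ v).2.2.2 := by
  induction v with
  | root => simp [genTriple, markov, evalWord, letterMatrix, Matrix.trace_fin_two]
  | left v ih =>
    simp only [genTriple, markov, map_mul, map_inv, trace_conj]
    exact ⟨ih.1, ih.2.2, ih.2.1⟩
  | right v ih =>
    simp only [genTriple, markov, map_mul, map_inv, trace_conj']
    exact ⟨ih.2.1, ih.1, ih.2.2⟩

/-- The inverse of a matrix of determinant one and trace `τ` is `τ - A`. -/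
theorem inv_eq_trace_sub {τ : ℤ} (A : Matrix.SpecialLinearGroup (Fin 2) ℤ)
    (h : Matrix.trace A.1 = τ) :
    (A⁻¹ : Matrix.SpecialLinearGroup (Fin 2) ℤ).1 =
      !![τ - A.1 0 0, -A.1 0 1; -A.1 1 0, τ - A.1 1 1] := by
  rw [Matrix.SpecialLinearGroup.coe_inv, Matrix.adjugate_fin_two, ← h, Matrix.trace_fin_two]
  ext i j
  fin_cases i <;> fin_cases j <;> simp

theorem coe_letterMatrix (k : Fin 3 → ℕ) (σ : Equiv.Perm (Fin 3)) (l : Letter) :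
    (letterMatrix k σ l).1 = match l with
      | .x => !![-(k (σ 0) : ℤ), -1; 1, 0]
      | .y => !![1, -1; (k (σ 1) : ℤ) + 2, -(k (σ 1) : ℤ) - 1]
      | .z => !![1, -(k (σ 2) : ℤ) - 2; 1, -(k (σ 2) : ℤ) - 1] := by
  cases l <;> rfl

/-- The negative of the conjugate of a matrix by `diag(-1, 1)`. -/
def signConj (M : Matrix (Fin 2) (Fin 2) ℤ) : Matrix (Fin 2) (Fin 2) ℤ :=
  !![-1, 0; 0, 1] * M * !![1, 0; 0, -1]

theorem signConj_eq (M : Matrix (Fin 2) (Fin 2) ℤ) :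
    signConj M = !![-M 0 0, M 0 1; M 1 0, -M 1 1] := by
  rw [Matrix.eta_fin_two M]
  simp [signConj]

theorem signConj_mul (M N : Matrix (Fin 2) (Fin 2) ℤ) :
    signConj M * signConj N = -signConj (M * N) := by
  simp only [signConj_eq, Matrix.mul_fin_two, Matrix.mul_apply, Fin.sum_univ_two]
  ext i j
  fin_cases i <;> fin_cases j <;> simp <;> ring

/-- This is the source of the constant matrices: applying `signConj` gives [[1, K], [0, 1]], and
`constMat k l` is `k l` times that matrix. -/
theorem evalWord_boundary (k : Fin 3 → ℕ) (σ : Equiv.Perm (Fin 3)) :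
    (evalWord k σ boundaryWord).1 = !![-1, bigK k; 0, -1] := by
  rw [bigK_eq k σ]
  simp only [boundaryWord, evalWord, map_mul, FreeGroup.lift_apply_of,
    Matrix.SpecialLinearGroup.coe_mul, coe_letterMatrix, Matrix.mul_fin_two]
  ext i j
  fin_cases i <;> fin_cases j <;> simp <;> ring

/-- The matrix of the word `T u⁻¹`, where `T` is the boundary word. -/
def cohnOf (k : Fin 3 → ℕ) (σ : Equiv.Perm (Fin 3)) (u : FreeGroup Letter) :
    Matrix (Fin 2) (Fin 2) ℤ :=
  signConj (evalWord k σ (boundaryWord * u⁻¹)).1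

/-- The product of the two words is T c, and c + c⁻¹ is the scalar tr(c) = -k l. The sign in
`signConj_mul` turns -T c into T c⁻¹ + k l · T, whose second summand becomes `constMat k l`. -/
theorem cohnOf_mul_sub (k : Fin 3 → ℕ) (σ : Equiv.Perm (Fin 3)) {a b c : FreeGroup Letter}
    {l : Fin 3} (h : a⁻¹ * boundaryWord * b⁻¹ = c)
    (hl : Matrix.trace (evalWord k σ c).1 = -k l) :
    cohnOf k σ a * cohnOf k σ b - constMat k l = cohnOf k σ c := by
  have e : boundaryWord * a⁻¹ * (boundaryWord * b⁻¹) = boundaryWord * c := by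
    rw [← h]; group
  rw [cohnOf, cohnOf, cohnOf, signConj_mul, ← Matrix.SpecialLinearGroup.coe_mul, ← map_mul, e,
    map_mul, map_mul, map_inv, Matrix.SpecialLinearGroup.coe_mul, Matrix.SpecialLinearGroup.coe_mul,
    inv_eq_trace_sub _ hl, evalWord_boundary]
  -- Determinant and trace have been used up in the formula for the inverse; what is left is an
  -- identity linear in the entries of an arbitrary matrix.
  generalize (evalWord k σ c).1 = M
  rw [Matrix.eta_fin_two M]
  simp only [signConj_eq, constMat]
  ext i j
  fin_cases i <;> fin_cases j <;> simp [Matrix.mul_apply, Fin.sum_univ_two] <;> ring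

theorem cohnTriple_eq (k : Fin 3 → ℕ) (σ : Equiv.Perm (Fin 3)) (v : TreeVertex) :
    cohnTriple k σ v = (cohnOf k σ (genTriple v).1, cohnOf k σ (genTriple v).2.1,
      cohnOf k σ (genTriple v).2.2) := by
  induction v with
  | root =>
    simp only [cohnTriple, cohnOf, signConj_eq, map_mul, Matrix.SpecialLinearGroup.coe_mul,
      evalWord_boundary, map_inv, Matrix.SpecialLinearGroup.coe_inv, genTriple]
    simp only [evalWord, FreeGroup.lift_apply_of, coe_letterMatrix, Matrix.adjugate_fin_two]
    refine Prod.ext ?_ (Prod.ext ?_ ?_) <;> ext i j <;> fin_cases i <;> fin_cases j <;>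
      simp <;> ring
  | left v ih =>
    have ht := trace_genTriple k σ (.left v)
    have hp := genTriple_prod v
    simp only [cohnTriple, ih, genTriple, markov] at ht ⊢
    rw [cohnOf_mul_sub k σ (by rw [← hp]; group) ht.2.1]
  | right v ih =>
    have ht := trace_genTriple k σ (.right v)
    have hp := genTriple_prod v
    simp only [cohnTriple, ih, genTriple, markov] at ht ⊢
    rw [cohnOf_mul_sub k σ (by rw [← hp]; group) ht.2.1]

/-! ### The coding of a rotation -/

/-- The power of `g` with exponent `1` or `-1` according to whether `P` is in the first half of an
interval of length `n`. -/
def halfSign (g : FreeGroup Letter) (P n : ℕ) : FreeGroup Letter := if 2 * P < n then g else g⁻¹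

/-- `RotationPath p q a b P Q w` says that `a` translations by `p` (from `[0, q)`) and `b`
translations by `-q` (from `[q, p + q)`) in the order dictated by the rotation by `p` on
`ℤ / (p + q)` lead from `P` to `Q`, and that `w` is the word read along the way. -/
inductive RotationPath (p q : ℕ) : ℕ → ℕ → ℕ → ℕ → FreeGroup Letter → Prop
  | nil (P : ℕ) : RotationPath p q 0 0 P P 1
  | low {a b P Q : ℕ} {w : FreeGroup Letter} (hP : P < q) (h : RotationPath p q a b (P + p) Q w) :
      RotationPath p q (a + 1) b P Q
        (halfSign (.of .y) P (p + q) * halfSign (.of .z) P q * w)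
  | high {a b P Q : ℕ} {w : FreeGroup Letter} (hP : P < p) (h : RotationPath p q a b P Q w) :
      RotationPath p q a (b + 1) (P + q) Q
        (halfSign (.of .y) (P + q) (p + q) * halfSign (.of .x) P p * w)

namespace RotationPath

variable {p q a b a' b' P Q R : ℕ} {w w' : FreeGroup Letter}

theorem cast (h : RotationPath p q a b P Q w) (ha : a = a') (hb : b = b') (hw : w = w') :
    RotationPath p q a' b' P Q w' := by
  subst ha hb hw; exact h

theorem start (h : RotationPath p q a b P Q w) (hP : P = R) : RotationPath p q a b R Q w := by
  subst hP; exact h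

theorem trans (h : RotationPath p q a b P Q w) (h' : RotationPath p q a' b' Q R w') :
    RotationPath p q (a + a') (b + b') P R (w * w') := by
  induction h with
  | nil P => exact h'.cast (by simp) (by simp) (by simp)
  | low hP _ ih => exact (low hP (ih h')).cast (by omega) (by omega) (by group)
  | high hP _ ih => exact (high hP (ih h')).cast (by omega) (by omega) (by group)

/-- The rotation is deterministic: a low step needs a position below q and a high step a position at
least q. So the start and the total number of steps fix the word. -/
theorem word_unique (h : RotationPath p q a b P Q w) {Q' : ℕ}
    (h' : RotationPath p q a' b' P Q' w') (hab : a + b = a' + b') : w = w' := by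
  induction h generalizing a' b' w' with
  | nil P =>
    cases h' with
    | nil => rfl
    | low => omega
    | high => omega
  | @low a b P Q w hP h ih =>
    cases h' with
    | nil => omega
    | low _ h' => rw [ih h' (by omega)]
    | high => omega
  | @high a b P Q w hP h ih =>
    generalize hS : P + q = S at h'
    cases h' with
    | nil => omega
    | low => omega
    | @high _ _ P' _ _ _ h' =>
      obtain rfl : P = P' := by omega
      rw [ih h' (by omega)]

/-- The rotation for (p, q) is the first return of the rotation for (p, p + q) to [0, p + q): a low
step stays one low step, a high step becomes low then high. After conjugation by y the substitution
sends y to z, z to y and x to y⁻¹xy. The y-signs then belong to the next position, which produces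
the coboundary factors at P and Q. -/
theorem left (h : RotationPath p q a b P Q w) :
    RotationPath p (p + q) (a + b) b P Q (halfSign (.of .y) P (p + (p + q)) *
      ((.of .y)⁻¹ * vertexHom (.left .root) w * .of .y) *
      (halfSign (.of .y) Q (p + (p + q)))⁻¹) := by
  induction h with
  | nil P => exact (nil P).cast rfl rfl (by simp)
  | @low a b P Q w hP h ih =>
    refine (low (by omega) ih).cast (by omega) rfl ?_
    -- The old sign of z at P is the new sign of y at P + p.
    have e : 2 * (P + p) < p + (p + q) ↔ 2 * P < q := by omega
    simp only [halfSign, e]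
    split_ifs <;> simp [genTriple, mul_assoc]
  | @high a b P Q w hP h ih =>
    refine (low (by omega) ((high hP ih).start (by omega))).cast (by omega) rfl ?_
    have e1 : ¬ 2 * (P + (p + q)) < p + (p + q) := by omega
    have e2 : 2 * P < p + (p + q) := by omega
    simp only [halfSign, e1, e2, if_true, if_false]
    split_ifs <;> simp [genTriple, mul_assoc]

/-- Mirror image of `left`: the first return of the rotation for (p + q, q) is taken to [q, p + 2q),
whence the shift of positions by q. Now a high step stays one high step, and a low step becomes high
then low. -/
theorem right_shifted (h : RotationPath p q a b P Q w) :
    RotationPath (p + q) q a (a + b) (P + q) (Q + q) (halfSign (.of .y) (P + q) (p + q + q) *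
      (.of .y * vertexHom (.right .root) w * (.of .y)⁻¹) *
      (halfSign (.of .y) (Q + q) (p + q + q))⁻¹) := by
  induction h with
  | nil P => exact (nil _).cast rfl rfl (by simp)
  | @low a b P Q w hP h ih =>
    refine (high (by omega) (low hP (ih.start (by omega)))).cast rfl (by omega) ?_
    have e1 : ¬ 2 * (P + p + q) < p + q + q := by omega
    have e2 : 2 * P < p + q + q := by omega
    simp only [halfSign, e1, e2, if_true, if_false]
    split_ifs <;> simp [genTriple, mul_assoc]
  | @high a b P Q w hP h ih =>
    refine (high (by omega) ih).cast rfl (by omega) ?_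
    have e : 2 * (P + q) < p + q + q ↔ 2 * P < p := by omega
    simp only [halfSign, e]
    split_ifs <;> simp [genTriple, mul_assoc]

/-- The induced closed path is based at q, not at 0. Its first step is high, from q to 0, and reads
yx; moving that step to the end bases the loop at 0 and conjugates the word by yx. -/
theorem right (hp : 0 < p) (ha : 0 < a + b) (h : RotationPath p q a b 0 0 w) :
    RotationPath (p + q) q a (a + b) 0 0
      ((.of .x)⁻¹ * (.of .y * vertexHom (.right .root) w * (.of .y)⁻¹) * .of .x) := by
  have h' := h.right_shifted
  generalize hS : 0 + q = S at h'
  generalize hB : a + b = B at h' ha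
  generalize hV : halfSign (.of .y) S (p + q + q) *
      (.of .y * vertexHom (.right .root) w * (.of .y)⁻¹) *
      (halfSign (.of .y) S (p + q + q))⁻¹ = V at h'
  have e1 : 2 * S < p + q + q := by omega
  have e2 : 2 * 0 < p + q := by omega
  simp only [halfSign, e1, if_true] at hV
  cases h' with
  | nil => omega
  | low => omega
  | @high _ b' P _ v hP h' =>
    obtain rfl : P = 0 := by omega
    have hl := high hP (nil (p := p + q) (q := q) 0)
    refine (h'.trans hl).cast (by omega) rfl ?_
    have e3 : 2 * (0 + q) < p + q + q := by omega
    simp only [halfSign, e2, e3, if_true] at hV ⊢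
    have hv : v = (.of .y * .of .x)⁻¹ * (.of .y * (.of .y * vertexHom (.right .root) w *
      (.of .y)⁻¹) * (.of .y)⁻¹) := by rw [hV]; group
    rw [hv]; group

end RotationPath

/-! ### Descent along the Euclidean algorithm -/

/-- The closed rotation path of coprime `p, q` reads a conjugate of `T u⁻¹`, where `u` is the middle
generator at the corresponding vertex; the statement is made relative to a base vertex `v`. -/
theorem exists_rotationPath (p q : ℕ) (hp : 0 < p) (hq : 0 < q) (h : Nat.Coprime p q) :
    ∃ w, RotationPath p q q p 0 0 w ∧ ∀ v, ∃ v',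
      (farey v').2.1 = ⟨q * (farey v).1.num + p * (farey v).2.2.num,
        q * (farey v).1.den + p * (farey v).2.2.den⟩ ∧
      vertexHom v (.of .x * w * (.of .x)⁻¹) = boundaryWord * (genTriple v').2.1⁻¹ := by
  induction hn : p + q using Nat.strong_induction_on generalizing p q with
  | _ n ih =>
    subst hn
    rcases lt_trichotomy p q with hlt | heq | hgt
    · obtain ⟨d, rfl⟩ := Nat.exists_eq_add_of_lt hlt
      obtain ⟨w, hw, hv⟩ := ih (p + (d + 1)) (by omega) p (d + 1) hp (by omega)
        (by simpa [Nat.add_assoc] using h) rfl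
      refine ⟨vertexHom (.left .root) w, (hw.left.cast (by omega) rfl ?_), fun v => ?_⟩
      · have e : 2 * 0 < p + (p + (d + 1)) := by omega
        simp only [halfSign, e, if_true]; group
      -- The smaller pair is used at the child of the base vertex: the base moves down the tree
      -- while (p, q) shrinks. This is why the induction quantifies over `v`.
      · obtain ⟨v', h1, h2⟩ := hv (.left v)
        refine ⟨v', h1.trans ?_, ?_⟩
        · simp only [farey, farey_mid v, Frac.mediant]
          ext <;> simp only <;> ring
        · rw [← h2, vertexHom_left v]; simp [genTriple]
    · subst heq
      have : p = 1 := by simpa using h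
      subst this
      -- For 1/1 the orbit is 0, 1, 0, and x(yzy⁻¹x)x⁻¹ = xyzy⁻¹ = T y⁻¹.
      refine ⟨.of .y * .of .z * (.of .y)⁻¹ * .of .x, ?_, fun v => ⟨v, ?_, ?_⟩⟩
      · refine RotationPath.cast (.low one_pos (.high (P := 0) one_pos (.nil 0))) rfl rfl ?_
        simp [halfSign, mul_assoc]
      · simp [farey_mid v, Frac.mediant]
      · rw [← genTriple_prod v]; simp [mul_assoc]
    · obtain ⟨d, rfl⟩ := Nat.exists_eq_add_of_lt hgt
      obtain ⟨w, hw, hv⟩ := ih ((d + 1) + q) (by omega) (d + 1) q (by omega) hq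
        (by simpa [Nat.add_assoc] using h) rfl
      have hw' := hw.right (by omega) (by omega)
      rw [show d + 1 + q = q + d + 1 by omega, show q + (d + 1) = q + d + 1 by omega] at hw'
      refine ⟨_, hw', fun v => ?_⟩
      obtain ⟨v', h1, h2⟩ := hv (.right v)
      refine ⟨v', h1.trans ?_, ?_⟩
      · simp only [farey, farey_mid v, Frac.mediant]
        ext <;> simp only <;> ring
      · rw [← h2, vertexHom_right v]; simp [genTriple, mul_assoc]

/-! ### The crossing sequence of the shifted segment -/

/-- The integer part of `p m / (p + q)`. -/
def rotFloor (p q m : ℕ) : ℕ := p * m / (p + q)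

/-- The position of `p m` modulo `p + q`. -/
def rotPos (p q m : ℕ) : ℕ := p * m % (p + q)

theorem rot_spec (p q m : ℕ) : p * m = (p + q) * rotFloor p q m + rotPos p q m :=
  (Nat.div_add_mod _ _).symm

theorem rotPos_lt {p q : ℕ} (m : ℕ) (hp : 0 < p) : rotPos p q m < p + q :=
  Nat.mod_lt _ (by omega)

theorem rot_eq {p q m f P : ℕ} (h : p * m = (p + q) * f + P) (hP : P < p + q) :
    rotFloor p q m = f ∧ rotPos p q m = P :=
  (Nat.div_mod_unique (by omega)).2 ⟨by omega, hP⟩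

theorem rotPos_succ_low {p q m : ℕ} (h : rotPos p q m < q) :
    rotPos p q (m + 1) = rotPos p q m + p :=
  (rot_eq (f := rotFloor p q m) (by linarith [rot_spec p q m]) (by omega)).2

theorem rotPos_succ_high {p q m : ℕ} (hp : 0 < p) (h : q ≤ rotPos p q m) :
    rotPos p q (m + 1) + q = rotPos p q m := by
  obtain ⟨d, hd⟩ := Nat.exists_eq_add_of_le h
  have hlt := rotPos_lt (q := q) m hp
  have := (rot_eq (p := p) (q := q) (m := m + 1) (f := rotFloor p q m + 1) (P := d)
    (by linarith [rot_spec p q m]) (by omega)).2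
  omega

/-- The `m`-th diagonal edge met by the shifted segment. -/
def diagEdge (p q m : ℕ) : GridEdge := ⟨.diagonal, (m : ℤ) - rotFloor p q m - 1, rotFloor p q m⟩

/-- The horizontal or vertical edge met after the `m`-th diagonal edge. -/
def stepEdge (p q m : ℕ) : GridEdge :=
  if rotPos p q m < q then ⟨.vertical, (m : ℤ) - rotFloor p q m, rotFloor p q m⟩
  else ⟨.horizontal, (m : ℤ) - rotFloor p q m - 1, rotFloor p q m + 1⟩

/-- The edges met by the shifted ray, in order. -/
def rotEdge (p q : ℕ) : ℕ → GridEdge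
  | 0 => ⟨.horizontal, -1, 0⟩
  | l + 1 => if l % 2 = 0 then diagEdge p q (l / 2) else stepEdge p q (l / 2)

theorem rotEdge_odd (p q m : ℕ) : rotEdge p q (2 * m + 1) = diagEdge p q m := by
  simp [rotEdge]

theorem rotEdge_even (p q m : ℕ) : rotEdge p q (2 * m + 2) = stepEdge p q m := by
  have h1 : (2 * m + 1) % 2 ≠ 0 := by omega
  have h2 : (2 * m + 1) / 2 = m := by omega
  simp only [rotEdge, h1, h2, if_false]

/-! ### Incidence of the segment with each kind of edge -/

theorem crossesAt_horizontal {t : ℚ} {ε s : ℝ} {i j : ℤ} :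
    CrossesAt t ε ⟨.horizontal, i, j⟩ s ↔
      s ∈ Set.Ico (0 : ℝ) 1 ∧ s * t.num = j ∧ i < s * t.den - ε ∧ s * t.den - ε < i + 1 := by
  refine and_congr_right fun _ => ?_
  constructor
  · rintro ⟨a, b, ha, hb, hab, h⟩
    simp only [GridEdge.fst, GridEdge.snd, shiftedPoint, Prod.smul_mk, Prod.mk_add_mk,
      smul_eq_mul, Prod.mk.injEq] at h
    obtain rfl : a = 1 - b := by linarith
    refine ⟨?_, ?_, ?_⟩ <;> nlinarith
  · rintro ⟨h1, h2, h3⟩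
    refine ⟨1 - (s * t.den - ε - i), s * t.den - ε - i, by linarith, by linarith, by ring, ?_⟩
    simp only [GridEdge.fst, GridEdge.snd, shiftedPoint, Prod.smul_mk, Prod.mk_add_mk,
      smul_eq_mul, Prod.mk.injEq, h1]
    constructor <;> ring

theorem crossesAt_vertical {t : ℚ} {ε s : ℝ} {i j : ℤ} :
    CrossesAt t ε ⟨.vertical, i, j⟩ s ↔
      s ∈ Set.Ico (0 : ℝ) 1 ∧ s * t.den - ε = i ∧ j < s * t.num ∧ s * t.num < j + 1 := by
  refine and_congr_right fun _ => ?_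
  constructor
  · rintro ⟨a, b, ha, hb, hab, h⟩
    simp only [GridEdge.fst, GridEdge.snd, shiftedPoint, Prod.smul_mk, Prod.mk_add_mk,
      smul_eq_mul, Prod.mk.injEq] at h
    obtain rfl : a = 1 - b := by linarith
    refine ⟨?_, ?_, ?_⟩ <;> nlinarith
  · rintro ⟨h1, h2, h3⟩
    refine ⟨1 - (s * t.num - j), s * t.num - j, by linarith, by linarith, by ring, ?_⟩
    simp only [GridEdge.fst, GridEdge.snd, shiftedPoint, Prod.smul_mk, Prod.mk_add_mk,
      smul_eq_mul, Prod.mk.injEq, h1]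
    constructor <;> ring

theorem crossesAt_diagonal {t : ℚ} {ε s : ℝ} {i j : ℤ} :
    CrossesAt t ε ⟨.diagonal, i, j⟩ s ↔
      s ∈ Set.Ico (0 : ℝ) 1 ∧ s * t.den - ε + s * t.num = i + j + 1 ∧
        j < s * t.num ∧ s * t.num < j + 1 := by
  refine and_congr_right fun _ => ?_
  constructor
  · rintro ⟨a, b, ha, hb, hab, h⟩
    simp only [GridEdge.fst, GridEdge.snd, shiftedPoint, Prod.smul_mk, Prod.mk_add_mk,
      smul_eq_mul, Prod.mk.injEq] at h
    obtain rfl : a = 1 - b := by linarith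
    refine ⟨?_, ?_, ?_⟩ <;> nlinarith
  · rintro ⟨h1, h2, h3⟩
    refine ⟨s * t.num - j, 1 - (s * t.num - j), by linarith, by linarith, by ring, ?_⟩
    simp only [GridEdge.fst, GridEdge.snd, shiftedPoint, Prod.smul_mk, Prod.mk_add_mk,
      smul_eq_mul, Prod.mk.injEq]
    constructor <;> linarith

theorem midpoint_prod (P Q : ℝ × ℝ) : midpoint ℝ P Q = ((P.1 + Q.1) / 2, (P.2 + Q.2) / 2) := by
  rw [midpoint_eq_smul_add]
  ext <;> simp <;> ring

/-- A segment that avoids vertices and midpoints avoids all half-integral points. -/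
theorem IsSmallShift.ne_half {t : ℚ} {ε ε' s : ℝ} (h : IsSmallShift t ε) (h0 : 0 < ε')
    (h1 : ε' ≤ ε) (hs : s ∈ Set.Icc (0 : ℝ) 1) (m n : ℤ) :
    shiftedPoint t ε' s ≠ ((m : ℝ) / 2, (n : ℝ) / 2) := by
  intro he
  obtain ⟨hv, hm⟩ := h.2 ε' h0 h1 s hs
  rcases Int.even_or_odd' m with ⟨i, rfl | rfl⟩ <;> rcases Int.even_or_odd' n with ⟨j, rfl | rfl⟩
  · refine hv i j (he.trans ?_)
    push_cast
    ext <;> simp only <;> ring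
  · refine hm ⟨.vertical, i, j⟩ (he.trans ?_)
    rw [midpoint_prod]
    push_cast
    ext <;> simp only [GridEdge.fst, GridEdge.snd] <;> ring
  · refine hm ⟨.horizontal, i, j⟩ (he.trans ?_)
    rw [midpoint_prod]
    push_cast
    ext <;> simp only [GridEdge.fst, GridEdge.snd] <;> ring
  · refine hm ⟨.diagonal, i, j⟩ (he.trans ?_)
    rw [midpoint_prod]
    push_cast
    ext <;> simp only [GridEdge.fst, GridEdge.snd] <;> ring

/-- Since p and q are coprime, some half-integral point (m/2, n/2) has qn - pm = 1, and it lies on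
the line translated by exactly 1/(2p). A larger shift would have swept over it. -/
theorem IsSmallShift.two_mul_lt {t : ℚ} (ht : 0 < t) {ε : ℝ} (h : IsSmallShift t ε) :
    2 * ε * t.num < 1 := by
  have hpz : 0 < t.num := Rat.num_pos.2 ht
  have hp : (0 : ℝ) < t.num := by exact_mod_cast hpz
  by_contra! hle
  have hc : IsCoprime t.num (t.den : ℤ) := Rat.isCoprime_num_den t
  obtain ⟨u, v, huv⟩ := hc
  have hv := Int.emod_add_mul_ediv v t.num
  have hn0 := Int.emod_nonneg v hpz.ne'
  have hn1 := Int.emod_lt_of_pos v hpz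
  -- Reducing the Bézout coefficient modulo p gives 0 ≤ n < p, so the point is met at the parameter
  -- n/(2p) in [0, 1].
  generalize v % t.num = n at *
  have hnR : (0 : ℝ) ≤ n := by exact_mod_cast hn0
  have hnR' : (n : ℝ) < t.num := by exact_mod_cast hn1
  have key : (t.den : ℤ) * n - t.num * (-(u + t.den * (v / t.num))) = 1 := by
    linear_combination huv + (t.den : ℤ) * hv
  generalize -(u + t.den * (v / t.num)) = m at key
  have key' : (t.den : ℝ) * n - t.num * m = 1 := by exact_mod_cast key
  refine h.ne_half (ε' := 1 / (2 * t.num)) (s := n / (2 * t.num)) (by positivity) ?_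
    ⟨by positivity, ?_⟩ m n ?_
  · rw [div_le_iff₀ (by positivity)]; linarith
  · rw [div_le_one (by positivity)]; linarith
  · simp only [shiftedPoint, Prod.mk.injEq]
    constructor
    · field_simp
      linarith
    · field_simp

/-! ### Enumeration of the crossed edges by the rotation -/

section

variable {t : ℚ} {ε : ℝ} {p q : ℕ}

theorem rot_spec_real (p q m : ℕ) :
    (p : ℝ) * m = (p + q) * rotFloor p q m + rotPos p q m := by
  exact_mod_cast rot_spec p q m

theorem crossParam_diagEdge (hp : (t.num : ℝ) = p) (hq : t.den = q) (m : ℕ) :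
    crossParam t ε (diagEdge p q m) = (m + ε) / (p + q) := by
  simp only [crossParam, diagEdge, hp, hq]
  push_cast
  congr 1
  ring

theorem crossParam_stepEdge_low (hq : t.den = q) {m : ℕ} (h : rotPos p q m < q) :
    crossParam t ε (stepEdge p q m) = (m - rotFloor p q m + ε) / q := by
  simp [crossParam, stepEdge, hq, h]

theorem crossParam_stepEdge_high (hp : (t.num : ℝ) = p) {m : ℕ} (h : ¬ rotPos p q m < q) :
    crossParam t ε (stepEdge p q m) = (rotFloor p q m + 1) / p := by
  simp [crossParam, stepEdge, hp, h]

theorem crossParam_strictMono (hp : (t.num : ℝ) = p) (hq : t.den = q) (hp0 : 0 < p) (hq0 : 0 < q)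
    (hε : 0 < ε) (hε' : 2 * ε * p < 1) : StrictMono fun l => crossParam t ε (rotEdge p q l) := by
  have hpR : (0 : ℝ) < p := by exact_mod_cast hp0
  have hqR : (0 : ℝ) < q := by exact_mod_cast hq0
  have hεp : 0 < ε * p := by positivity
  refine strictMono_nat_of_lt_succ fun l => ?_
  rcases l with _ | l
  · rw [show 0 + 1 = 2 * 0 + 1 from rfl, rotEdge_odd, crossParam_diagEdge hp hq]
    simp only [rotEdge, crossParam]
    simp only [Int.cast_zero, zero_div, Nat.cast_zero, zero_add]
    positivity
  have hs := rot_spec_real p q (l / 2)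
  have hlt : (rotPos p q (l / 2) : ℝ) + 1 ≤ p + q := by
    exact_mod_cast rotPos_lt (q := q) (l / 2) hp0
  rcases Nat.even_or_odd' l with ⟨m, rfl | rfl⟩
  · rw [rotEdge_odd, rotEdge_even, crossParam_diagEdge hp hq]
    rw [show 2 * m / 2 = m by omega] at hs hlt
    by_cases h : rotPos p q m < q
    · rw [crossParam_stepEdge_low hq h, div_lt_div_iff₀ (by positivity) hqR]
      have : (0 : ℝ) ≤ rotPos p q m := by positivity
      nlinarith
    · rw [crossParam_stepEdge_high hp h, div_lt_div_iff₀ (by positivity) hpR]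
      nlinarith
  · rw [show 2 * m + 1 + 1 + 1 = 2 * (m + 1) + 1 by ring, rotEdge_odd, rotEdge_even,
      crossParam_diagEdge hp hq]
    rw [show (2 * m + 1) / 2 = m by omega] at hs hlt
    push_cast
    by_cases h : rotPos p q m < q
    · rw [crossParam_stepEdge_low hq h, div_lt_div_iff₀ hqR (by positivity)]
      have : (rotPos p q m : ℝ) + 1 ≤ q := by exact_mod_cast h
      nlinarith
    · rw [crossParam_stepEdge_high hp h, div_lt_div_iff₀ hpR (by positivity)]
      have : (q : ℝ) ≤ rotPos p q m := by exact_mod_cast not_lt.1 h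
      nlinarith

/-- The last position before the orbit closes is q, so the last step is high: the edge with index
2(p + q) is the horizontal one through the excluded terminal point. -/
theorem rot_last (hp0 : 0 < p) : rotFloor p q (p + q - 1) = p - 1 ∧ rotPos p q (p + q - 1) = q := by
  refine rot_eq ?_ (by omega)
  obtain ⟨p, rfl⟩ := Nat.exists_eq_add_of_lt hp0
  simp only [zero_add, Nat.add_sub_cancel, show p + 1 + q - 1 = p + q by omega]
  ring

theorem rotEdge_last (hp0 : 0 < p) : rotEdge p q (2 * (p + q)) = ⟨.horizontal, q - 1, p⟩ := by
  obtain ⟨h1, h2⟩ := rot_last (q := q) hp0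
  rw [show 2 * (p + q) = 2 * (p + q - 1) + 2 by omega, rotEdge_even, stepEdge, h1, h2,
    if_neg (lt_irrefl q)]
  congr 1 <;> omega

theorem crossesAt_rotEdge (hp : (t.num : ℝ) = p) (hq : t.den = q) (hp0 : 0 < p) (hq0 : 0 < q)
    (hε : 0 < ε) (hε' : 2 * ε * p < 1) {l : ℕ} (hl : l < 2 * (p + q)) :
    CrossesAt t ε (rotEdge p q l) (crossParam t ε (rotEdge p q l)) := by
  have hpR : (0 : ℝ) < p := by exact_mod_cast hp0
  have hqR : (0 : ℝ) < q := by exact_mod_cast hq0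
  have hp1 : (1 : ℝ) ≤ p := by exact_mod_cast hp0
  have hεp : 0 < ε * p := by positivity
  have hmono := crossParam_strictMono hp hq hp0 hq0 hε hε'
  -- The edges with indices 0 and 2(p + q) have parameters 0 and 1, so monotonicity puts all edges
  -- between them in [0, 1).
  have hmem : crossParam t ε (rotEdge p q l) ∈ Set.Ico (0 : ℝ) 1 := by
    constructor
    · have := hmono.monotone (Nat.zero_le l)
      simpa [rotEdge, crossParam] using this
    · have := hmono hl
      simp only [rotEdge_last hp0] at this
      simpa [crossParam, hp, hpR.ne'] using this
  rcases l with _ | l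
  · simp only [rotEdge, crossParam] at hmem ⊢
    rw [crossesAt_horizontal]
    refine ⟨hmem, by simp, ?_, ?_⟩ <;> simp <;> nlinarith
  have hs := rot_spec_real p q (l / 2)
  have hlt : (rotPos p q (l / 2) : ℝ) + 1 ≤ p + q := by
    exact_mod_cast rotPos_lt (q := q) (l / 2) hp0
  have hnn : (0 : ℝ) ≤ rotPos p q (l / 2) := by positivity
  rcases Nat.even_or_odd' l with ⟨m, rfl | rfl⟩
  · rw [rotEdge_odd] at hmem ⊢
    rw [show 2 * m / 2 = m by omega] at hs hlt hnn
    have hc := crossParam_diagEdge (ε := ε) hp hq m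
    generalize crossParam t ε (diagEdge p q m) = s at *
    rw [eq_div_iff (by positivity)] at hc
    rw [diagEdge, crossesAt_diagonal, hp, hq]
    -- The height above the lower end of the edge is (position + εp)/(p + q). The term εp makes it
    -- positive even at position 0, and being below 1 it cannot lift the position p + q - 1 to the
    -- top.
    have e : (p + q) * (s * p - rotFloor p q m) = rotPos p q m + ε * p := by
      linear_combination (p : ℝ) * hc + hs
    refine ⟨hmem, by push_cast; linear_combination hc, ?_, ?_⟩
    · push_cast
      rw [← sub_pos]
      exact pos_of_mul_pos_right (b := s * p - rotFloor p q m) (by rw [e]; linarith)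
        (by positivity : (0 : ℝ) ≤ p + q)
    · push_cast
      refine lt_of_mul_lt_mul_left (a := (p + q : ℝ)) ?_ (by positivity)
      linarith
  · rw [show 2 * m + 1 + 1 = 2 * m + 2 by ring, rotEdge_even] at hmem ⊢
    rw [show (2 * m + 1) / 2 = m by omega] at hs hlt hnn
    by_cases h : rotPos p q m < q
    · have hc := crossParam_stepEdge_low (ε := ε) hq h
      generalize crossParam t ε (stepEdge p q m) = s at *
      rw [eq_div_iff (by positivity)] at hc
      rw [stepEdge, if_pos h, crossesAt_vertical, hp, hq]
      have e : q * (s * p - rotFloor p q m) = rotPos p q m + ε * p := by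
        linear_combination (p : ℝ) * hc + hs
      have h' : (rotPos p q m : ℝ) + 1 ≤ q := by exact_mod_cast h
      refine ⟨hmem, by push_cast; linear_combination hc, ?_, ?_⟩
      · push_cast
        refine lt_of_mul_lt_mul_left (a := (q : ℝ)) ?_ (by positivity)
        linarith
      · push_cast
        refine lt_of_mul_lt_mul_left (a := (q : ℝ)) ?_ (by positivity)
        linarith
    · have hc := crossParam_stepEdge_high (ε := ε) hp h
      generalize crossParam t ε (stepEdge p q m) = s at *
      rw [eq_div_iff (by positivity)] at hc
      rw [stepEdge, if_neg h, crossesAt_horizontal, hp, hq]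
      have e : p * (m - rotFloor p q m - (s * q - ε)) = rotPos p q m - q + ε * p := by
        linear_combination -(q : ℝ) * hc + hs
      have h' : (q : ℝ) ≤ rotPos p q m := by exact_mod_cast not_lt.1 h
      refine ⟨hmem, by push_cast; linear_combination hc, ?_, ?_⟩
      · push_cast
        refine lt_of_mul_lt_mul_left (a := (p : ℝ)) ?_ (by positivity)
        linarith
      · push_cast
        refine lt_of_mul_lt_mul_left (a := (p : ℝ)) ?_ (by positivity)
        linarith

theorem exists_rotEdge_eq (hp : (t.num : ℝ) = p) (hq : t.den = q) (hp0 : 0 < p) (hq0 : 0 < q)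
    (hε : 0 < ε) (hε' : 2 * ε * p < 1) {e : GridEdge} {s : ℝ} (h : CrossesAt t ε e s) :
    ∃ l < 2 * (p + q), rotEdge p q l = e := by
  have hpR : (0 : ℝ) < p := by exact_mod_cast hp0
  have hqR : (0 : ℝ) < q := by exact_mod_cast hq0
  have hp1 : (1 : ℝ) ≤ p := by exact_mod_cast hp0
  have hεp : 0 < ε * p := by positivity
  have hε1 : ε < 1 := by nlinarith
  obtain ⟨kd, i, j⟩ := e
  cases kd
  · rw [crossesAt_horizontal, hp, hq] at h
    obtain ⟨⟨h0, h1⟩, h2, h3, h4⟩ := h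
    have hj0 : 0 ≤ j := by
      have : (0 : ℝ) ≤ j := by rw [← h2]; positivity
      exact_mod_cast this
    have hjp : j < p := by
      have : (j : ℝ) < p := by rw [← h2]; nlinarith
      exact_mod_cast this
    have a1 : (p : ℤ) * i < j * q := by
      have : (p : ℝ) * i < j * q := by rw [← h2]; nlinarith
      exact_mod_cast this
    -- The slack +1 absorbs εp < 1; between integers the bound is then the exact inequality ≤
    -- without shift. The other two edge kinds use the same device.
    have a2 : j * q < (p : ℤ) * i + p + 1 := by
      have : (j : ℝ) * q < p * i + p + 1 := by rw [← h2]; nlinarith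
      exact_mod_cast this
    rcases hj0.eq_or_lt with rfl | hj
    · refine ⟨0, by omega, ?_⟩
      have b1 : i < 0 := by nlinarith
      have b2 : -2 < i := by nlinarith
      obtain rfl : i = -1 := by omega
      rfl
    · have hi : 0 ≤ i := by nlinarith
      have hiq : i < q := by nlinarith
      lift i to ℕ using hi
      lift j to ℕ using hj0
      obtain ⟨f, rfl⟩ : ∃ f, j = f + 1 := ⟨j - 1, by omega⟩
      have a3 : p * i < (f + 1) * q := by exact_mod_cast a1
      have a4 : (f + 1) * q < p * i + p + 1 := by exact_mod_cast a2
      obtain ⟨d, hd⟩ := Nat.exists_eq_add_of_le (show (f + 1) * q ≤ p * i + p by omega)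
      -- The diagonal met just before this edge lies on x + y = i + f + 1, the antidiagonal through
      -- the left end of the edge.
      obtain ⟨r1, r2⟩ := rot_eq (p := p) (q := q) (m := i + (f + 1)) (f := f) (P := q + d)
        (by nlinarith) (by omega)
      refine ⟨2 * (i + (f + 1)) + 2, by omega, ?_⟩
      rw [rotEdge_even, stepEdge, r1, r2, if_neg (by omega)]
      congr 1
      push_cast; ring
  · rw [crossesAt_diagonal, hp, hq] at h
    obtain ⟨⟨h0, h1⟩, h2, h3, h4⟩ := h
    obtain ⟨m, hm⟩ : ∃ m, m = i + j + 1 := ⟨_, rfl⟩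
    obtain rfl : i = m - j - 1 := by omega
    have h2' : s * (p + q) = m + ε := by push_cast at h2; linear_combination h2
    have hm0 : 0 ≤ m := by
      have : (-1 : ℝ) < m := by nlinarith
      have : -1 < m := by exact_mod_cast this
      omega
    have hmn : m < p + q := by
      have : (m : ℝ) < p + q := by nlinarith
      exact_mod_cast this
    have h5 : s * (p + q) * p = (m + ε) * p := by rw [h2']
    have a1 : ((p : ℤ) + q) * j < p * m + 1 := by
      have : ((p : ℝ) + q) * j < p * m + 1 := by nlinarith
      exact_mod_cast this
    have a2 : (p : ℤ) * m < (p + q) * j + (p + q) := by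
      have : (p : ℝ) * m < (p + q) * j + (p + q) := by nlinarith
      exact_mod_cast this
    have hj0 : 0 ≤ j := by
      by_contra! hj
      nlinarith
    lift m to ℕ using hm0
    lift j to ℕ using hj0
    have a3 : (p + q) * j < p * m + 1 := by exact_mod_cast a1
    have a4 : p * m < (p + q) * j + (p + q) := by exact_mod_cast a2
    obtain ⟨d, hd⟩ := Nat.exists_eq_add_of_le (show (p + q) * j ≤ p * m by omega)
    obtain ⟨r1, r2⟩ := rot_eq hd (by omega)
    exact ⟨2 * m + 1, by omega, by rw [rotEdge_odd, diagEdge, r1]⟩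
  · rw [crossesAt_vertical, hp, hq] at h
    obtain ⟨⟨h0, h1⟩, h2, h3, h4⟩ := h
    have h2' : s * q = i + ε := by linear_combination h2
    have hi0 : 0 ≤ i := by
      have : (-1 : ℝ) < i := by nlinarith
      have : -1 < i := by exact_mod_cast this
      omega
    have hiq : i < q := by
      have : (i : ℝ) < q := by nlinarith
      exact_mod_cast this
    have h5 : s * q * p = (i + ε) * p := by rw [h2']
    have a1 : (q : ℤ) * j < p * i + 1 := by
      have : (q : ℝ) * j < p * i + 1 := by nlinarith
      exact_mod_cast this
    have a2 : (p : ℤ) * i < q * j + q := by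
      have : (p : ℝ) * i < q * j + q := by nlinarith
      exact_mod_cast this
    have hj0 : 0 ≤ j := by
      by_contra! hj
      nlinarith
    have hjp : j < p := by nlinarith
    lift i to ℕ using hi0
    lift j to ℕ using hj0
    have a3 : q * j < p * i + 1 := by exact_mod_cast a1
    have a4 : p * i < q * j + q := by exact_mod_cast a2
    obtain ⟨d, hd⟩ := Nat.exists_eq_add_of_le (show q * j ≤ p * i by omega)
    obtain ⟨r1, r2⟩ := rot_eq (p := p) (q := q) (m := i + j) (f := j) (P := d)
      (by nlinarith) (by omega)
    refine ⟨2 * (i + j) + 2, by omega, ?_⟩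
    rw [rotEdge_even, stepEdge, r1, r2, if_pos (by omega)]
    congr 1
    push_cast; ring

/-- Both lists have the same members without repetition and are sorted by the crossing parameter,
which is injective on them; so the sorted order is unique. -/
theorem crossingSequence_eq (hp : (t.num : ℝ) = p) (hq : t.den = q) (hp0 : 0 < p) (hq0 : 0 < q)
    (hε : 0 < ε) (hε' : 2 * ε * p < 1) :
    crossingSequence t ε = (List.range (2 * (p + q))).map (rotEdge p q) := by
  have hmono := crossParam_strictMono hp hq hp0 hq0 hε hε'
  have hpw : ((List.range (2 * (p + q))).map (rotEdge p q)).Pairwise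
      fun e e' => crossParam t ε e < crossParam t ε e' := by
    rw [List.pairwise_map]
    exact List.pairwise_lt_range.imp fun h => hmono h
  have hmem : ∀ e, e ∈ (crossedEdges_finite t ε).toFinset.toList ↔
      e ∈ (List.range (2 * (p + q))).map (rotEdge p q) := by
    intro e
    simp only [Finset.mem_toList, Set.Finite.mem_toFinset, List.mem_map, List.mem_range]
    constructor
    · rintro ⟨s, hs⟩
      exact exists_rotEdge_eq hp hq hp0 hq0 hε hε' hs
    · rintro ⟨l, hl, rfl⟩
      exact ⟨_, crossesAt_rotEdge hp hq hp0 hq0 hε hε' hl⟩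
  have hperm : ((crossedEdges_finite t ε).toFinset.toList).Perm
      ((List.range (2 * (p + q))).map (rotEdge p q)) :=
    (List.perm_ext_iff_of_nodup (Finset.nodup_toList _)
      (hpw.imp fun h he => h.ne (by rw [he]))).2 hmem
  have hinj : ∀ e e', e ∈ (List.range (2 * (p + q))).map (rotEdge p q) →
      e' ∈ (List.range (2 * (p + q))).map (rotEdge p q) →
      crossParam t ε e = crossParam t ε e' → e = e' := by
    intro e e' he he' h
    obtain ⟨l, -, rfl⟩ := List.mem_map.1 he
    obtain ⟨l', -, rfl⟩ := List.mem_map.1 he'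
    rw [hmono.injective h]
  have hperm' := (List.mergeSort_perm (crossedEdges_finite t ε).toFinset.toList
    fun e e' => decide (crossParam t ε e ≤ crossParam t ε e')).trans hperm
  refine List.Perm.eq_of_pairwise (le := fun e e' => crossParam t ε e ≤ crossParam t ε e')
    (fun e e' he he' h h' => hinj e e' (hperm'.subset he) he' (le_antisymm h h')) ?_
    (hpw.imp fun h => h.le) hperm'
  have := List.pairwise_mergeSort (le := fun e e' => decide (crossParam t ε e ≤ crossParam t ε e'))
    (fun a b c h h' => by simp only [decide_eq_true_eq] at *; exact h.trans h')
    (fun a b => by simpa using le_total _ _) (crossedEdges_finite t ε).toFinset.toList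
  exact this.imp fun h => by simpa using h

/-! ### The word read along the crossing sequence -/

/-- As n - 2P is an integer and 0 < 2εp < 1, the shift decides only the tie n = 2P, where the
midpoint is on the unshifted line: it then falls on the right. This matches the strict inequality in
`halfSign`. -/
theorem edgeLetter_eq_halfSign {e : GridEdge} {P n : ℕ} (hε : 0 < ε) (hp0 : 0 < p)
    (hε' : 2 * ε * p < 1)
    (h : (t.den : ℝ) * (midpoint ℝ e.fst e.snd).2 - t.num * ((midpoint ℝ e.fst e.snd).1 + ε) =
      (n - 2 * P - 2 * ε * p) / 2) :
    edgeLetter t ε e = halfSign (.of e.kind.letter) P n := by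
  have hpR : (0 : ℝ) < p := by exact_mod_cast hp0
  have hεp : 0 < ε * p := by positivity
  rw [edgeLetter, halfSign, OnRight, h]
  by_cases hP : 2 * P < n
  · have : (2 * P : ℝ) + 1 ≤ n := by exact_mod_cast hP
    rw [if_neg (by linarith), if_pos hP]
  · have : (n : ℝ) ≤ 2 * P := by exact_mod_cast not_lt.1 hP
    rw [if_pos (by linarith), if_neg hP]

theorem edgeLetter_diagEdge (hp : (t.num : ℝ) = p) (hq : t.den = q) (hp0 : 0 < p)
    (hε : 0 < ε) (hε' : 2 * ε * p < 1) (m : ℕ) :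
    edgeLetter t ε (diagEdge p q m) = halfSign (.of .y) (rotPos p q m) (p + q) := by
  refine edgeLetter_eq_halfSign hε hp0 hε' ?_
  have hs := rot_spec_real p q m
  rw [midpoint_prod, hp, hq]
  simp only [diagEdge, GridEdge.fst, GridEdge.snd]
  push_cast
  linear_combination -hs

theorem edgeLetter_stepEdge_low (hp : (t.num : ℝ) = p) (hq : t.den = q) (hp0 : 0 < p)
    (hε : 0 < ε) (hε' : 2 * ε * p < 1) {m : ℕ} (h : rotPos p q m < q) :
    edgeLetter t ε (stepEdge p q m) = halfSign (.of .z) (rotPos p q m) q := by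
  rw [stepEdge, if_pos h]
  refine edgeLetter_eq_halfSign hε hp0 hε' ?_
  have hs := rot_spec_real p q m
  rw [midpoint_prod, hp, hq]
  simp only [GridEdge.fst, GridEdge.snd]
  push_cast
  linear_combination -hs

/-- The sign depends on the position after the step, which is the offset of the old position from q.
-/
theorem edgeLetter_stepEdge_high (hp : (t.num : ℝ) = p) (hq : t.den = q) (hp0 : 0 < p)
    (hε : 0 < ε) (hε' : 2 * ε * p < 1) {m : ℕ} (h : ¬ rotPos p q m < q) :
    edgeLetter t ε (stepEdge p q m) = halfSign (.of .x) (rotPos p q (m + 1)) p := by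
  rw [stepEdge, if_neg h]
  refine edgeLetter_eq_halfSign hε hp0 hε' ?_
  have hs := rot_spec_real p q m
  have hr : (rotPos p q (m + 1) : ℝ) + q = rotPos p q m := by
    exact_mod_cast rotPos_succ_high hp0 (not_lt.1 h)
  rw [midpoint_prod, hp, hq]
  simp only [GridEdge.fst, GridEdge.snd]
  push_cast
  linear_combination -hs + hr

theorem edgeLetter_first (hp : (t.num : ℝ) = p) (hp0 : 0 < p)
    (hε : 0 < ε) (hε' : 2 * ε * p < 1) : edgeLetter t ε (rotEdge p q 0) = .of .x := by
  rw [rotEdge, edgeLetter_eq_halfSign (P := 0) (n := p) hε hp0 hε', halfSign, if_pos (by omega)]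
  · rfl
  · rw [midpoint_prod, hp]
    simp only [GridEdge.fst, GridEdge.snd]
    push_cast
    ring

theorem edgeLetter_last (hp : (t.num : ℝ) = p) (hq : t.den = q) (hp0 : 0 < p)
    (hε : 0 < ε) (hε' : 2 * ε * p < 1) :
    edgeLetter t ε (rotEdge p q (2 * (p + q))) = .of .x := by
  rw [rotEdge_last hp0, edgeLetter_eq_halfSign (P := 0) (n := p) hε hp0 hε', halfSign,
    if_pos (by omega)]
  · rfl
  · rw [midpoint_prod, hp, hq]
    simp only [GridEdge.fst, GridEdge.snd]
    push_cast
    ring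

/-- The 2m + 1 edges are the horizontal one at the initial point, which reads x, followed by m
pairs, each a diagonal and one step of the rotation. -/
theorem exists_rotationPath_prefix (hp : (t.num : ℝ) = p) (hq : t.den = q) (hp0 : 0 < p)
    (hε : 0 < ε) (hε' : 2 * ε * p < 1) (m : ℕ) :
    ∃ a b w, a + b = m ∧ RotationPath p q a b 0 (rotPos p q m) w ∧
      (((List.range (2 * m + 1)).map (rotEdge p q)).map (edgeLetter t ε)).prod = .of .x * w := by
  induction m with
  | zero =>
    refine ⟨0, 0, 1, rfl, (RotationPath.nil 0 : RotationPath p q 0 0 0 0 1), ?_⟩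
    simp [edgeLetter_first hp hp0 hε hε']
  | succ m ih =>
    obtain ⟨a, b, w, hab, hw, hprod⟩ := ih
    have hr : (((List.range (2 * (m + 1) + 1)).map (rotEdge p q)).map (edgeLetter t ε)).prod =
        .of .x * (w * (edgeLetter t ε (diagEdge p q m) * edgeLetter t ε (stepEdge p q m))) := by
      rw [show 2 * (m + 1) + 1 = 2 * m + 1 + 1 + 1 by ring, List.range_succ, List.range_succ]
      simp only [List.map_append, List.prod_append, hprod, List.map_cons, List.map_nil,
        List.prod_singleton, rotEdge_odd]
      rw [show 2 * m + 1 + 1 = 2 * m + 2 by ring, rotEdge_even]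
      group
    rw [hr, edgeLetter_diagEdge hp hq hp0 hε hε']
    by_cases h : rotPos p q m < q
    · rw [edgeLetter_stepEdge_low hp hq hp0 hε hε' h]
      refine ⟨a + 1, b + 0, _, by omega, hw.trans (a' := 1) (b' := 0) ?_, rfl⟩
      rw [rotPos_succ_low h]
      simpa using RotationPath.low h (RotationPath.nil _)
    · rw [edgeLetter_stepEdge_high hp hq hp0 hε hε' h]
      refine ⟨a + 0, b + 1, _, by omega, hw.trans (a' := 0) (b' := 1) ?_, rfl⟩
      have hs := rotPos_succ_high hp0 (not_lt.1 h)
      have hlt := rotPos_lt (q := q) m hp0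
      rw [← hs]
      simpa using RotationPath.high (p := p) (q := q) (by omega)
        (RotationPath.nil (rotPos p q (m + 1)))

/-- For m = p + q the prefix runs one edge too far: it includes the edge at the terminal point,
which also reads x. Cancelling that letter gives the factor x⁻¹, while the included initial point
gives the leading x. -/
theorem completedWord_eq (hp : (t.num : ℝ) = p) (hq : t.den = q) (hp0 : 0 < p) (hq0 : 0 < q)
    (hε : 0 < ε) (hε' : 2 * ε * p < 1) {w : FreeGroup Letter}
    (hw : RotationPath p q q p 0 0 w) : completedWord t ε = .of .x * w * (.of .x)⁻¹ := by
  obtain ⟨a, b, w', hab, hw', hprod⟩ := exists_rotationPath_prefix hp hq hp0 hε hε' (p + q)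
  rw [hw.word_unique hw' (by omega), ← hprod, completedWord,
    crossingSequence_eq hp hq hp0 hq0 hε hε', List.range_succ]
  simp [edgeLetter_last hp hq hp0 hε hε']

end

/-! ### The completed word as the word of its vertex, and the conclusion -/

theorem completedWord_eq_vertex {t : ℚ} (ht : 0 < t) {ε : ℝ} (hε : IsSmallShift t ε) :
    completedWord t ε = boundaryWord * (genTriple (vertexOf t ht)).2.1⁻¹ := by
  have hnum : 0 < t.num := Rat.num_pos.2 ht
  have hpz : (t.num.toNat : ℤ) = t.num := Int.toNat_of_nonneg hnum.le
  have hp : (t.num : ℝ) = (t.num.toNat : ℕ) := by exact_mod_cast hpz.symm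
  have hlt := hε.two_mul_lt ht
  rw [hp] at hlt
  obtain ⟨w, hw, hv⟩ := exists_rotationPath t.num.toNat t.den (by omega) t.den_pos (by
    have := t.reduced
    rwa [show t.num.natAbs = t.num.toNat by omega] at this)
  obtain ⟨v, h1, h2⟩ := hv .root
  have hvt : v = vertexOf t ht := by
    refine farey_mid_injective _ _ (h1.trans ?_)
    rw [vertexOf, (existsUnique_vertex t ht).choose_spec.1]
    simp [farey]
  rw [completedWord_eq hp rfl (by omega) t.den_pos hε.1 hlt hw, ← hvt, ← h2, vertexHom_root]

end GenCohn

theorem theorem5p4 (k : Fin 3 → ℕ) (σ : Equiv.Perm (Fin 3)) (t : ℚ) (ht : 0 < t)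
    (ε : ℝ) (hε : GenCohn.IsSmallShift t ε) :
    GenCohn.cohnMatrix k σ t ht =
      !![-1, 0; 0, 1] * GenCohn.completedMatrix k σ t ε * !![1, 0; 0, -1] := by
  rw [GenCohn.cohnMatrix, GenCohn.cohnTriple_eq, GenCohn.completedMatrix,
    GenCohn.completedWord_eq_vertex ht hε]
  rfl
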